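/- Let $d\ge 2$, $\alpha\in(1,2)$, $\delta\in(0,1-1/\alpha]$, $a>1$ and $R>0$. Let $(X_t)_{t\ge 0}$ be the $\mathbb{R}^d$-valued symmetric $\alpha$-stable process started at $0$, i.e. the càdlàg Lévy process with $\mathbb{E}[e^{i\langle \xi,X_t\rangle}]=e^{-t|\xi|^\alpha}$ for $\xi\in\mathbb{R}^d$, $t\ge 0$, and let $\tau_B(0):=\inf\{t\ge 0 : X_t\notin B(0,R)\}$ be its exit time from the open ball $B(0,R)$ of radius $R$ centred at $0$. Let $\kappa_1,\kappa_2>0$ be such that $$\rho(t):=\kappa_1 t^{\delta-1}e^{-t}\mathbf{1}_{[0,1]}(t)+\frac{\kappa_2}{t^{a}}\mathbf{1}_{(1,\infty)}(t),\qquad t>0,$$ is a probability density function on $(0,\infty)$, and let $\overline F(s):=\int_s^\infty\rho(t)\,dt$, with $\overline F(\infty)=0$ and the convention $1/0=\infty$. Then $\rho$ satisfies the following two conditions (Assumption (C)): $$\text{(i)}\quad \sup_{t\in(0,1]}\frac{1}{\rho(t)\,t^{1/\alpha}}<\infty,\qquad\qquad \text{(ii)}\quad \mathbb{E}\!\left[\frac{1}{\overline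 F(\tau_B(0))}\right]=\mathbb{E}\!\left[\left(\int_{\tau_B(0)}^\infty\rho(t)\,dt\right)^{-1}\right]<\infty .$$ -/

import Mathlib

open MeasureTheory ProbabilityTheory Filter Topology
open scoped NNReal ENNReal

noncomputable section

/-- A path `ℝ₊ → E` is càdlàg: right-continuous, with left limits. -/
def IsCadlagPath {E : Type*} [TopologicalSpace E] (f : ℝ≥0 → E) : Prop :=
  ∀ t : ℝ≥0, ContinuousWithinAt f (Set.Ici t) t ∧ ∃ l : E, Tendsto f (𝓝[<] t) (𝓝 l)

/-- `X` is an `ℝᵈ`-valued (rotationally) symmetric `α`-stable process started at `0`, that is, the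
Lévy process with generator `-(-Δ)^{α/2}`: it starts at `0`, has independent increments,
its increments over an interval of length `t` have characteristic function `ξ ↦ exp (-t |ξ|^α)`
(so they are stationary), and it has càdlàg paths almost surely. -/
structure IsSymmetricStableProcess {Ω : Type*} [MeasurableSpace Ω] {d : ℕ} (α : ℝ)
    (X : ℝ≥0 → Ω → EuclideanSpace ℝ (Fin d)) (P : Measure Ω) : Prop where
  measurable : ∀ t, Measurable (X t)
  start : ∀ᵐ ω ∂P, X 0 ω = 0
  indep_increments : HasIndepIncrements X P
  charFun_increment : ∀ (s t : ℝ≥0) (ξ : EuclideanSpace ℝ (Fin d)),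
    charFun (P.map (fun ω => X (s + t) ω - X s ω)) ξ
      = Complex.exp (((-((t : ℝ) * ‖ξ‖ ^ α) : ℝ)) : ℂ)
  cadlag : ∀ᵐ ω ∂P, IsCadlagPath (fun t => X t ω)

/-- The exit time `τ_B(x) = inf {t ≥ 0 : x + X_t ∉ B(0,R)}` from the open ball, in `[0,∞]`
(equal to `∞` if the path never leaves the ball). -/
def exitTime {Ω : Type*} {d : ℕ} (R : ℝ) (X : ℝ≥0 → Ω → EuclideanSpace ℝ (Fin d))
    (x : EuclideanSpace ℝ (Fin d)) (ω : Ω) : ℝ≥0∞ :=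
  ⨅ (t : ℝ≥0) (_ : x + X t ω ∉ Metric.ball (0 : EuclideanSpace ℝ (Fin d)) R), (t : ℝ≥0∞)

/-- The tail `F̄(s) = ∫_s^∞ ρ(t) dt` of a density `ρ` on `(0,∞)`, for `s ∈ [0,∞]`; `F̄(∞) = 0`. -/
def tailFun (ρ : ℝ → ℝ) (s : ℝ≥0∞) : ℝ≥0∞ :=
  ∫⁻ t in {t : ℝ | 0 < t ∧ s < ENNReal.ofReal t}, ENNReal.ofReal (ρ t)

/-- The density `ρ` satisfies Assumption (C), for the process `X` and the ball `B(0,R)`.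
Both quantities are computed in `[0,∞]`, with `1/0 = ∞`. -/
structure AssumptionC {Ω : Type*} [MeasurableSpace Ω] {d : ℕ} (α R : ℝ)
    (X : ℝ≥0 → Ω → EuclideanSpace ℝ (Fin d)) (P : Measure Ω) (ρ : ℝ → ℝ) : Prop where
  /-- `sup_{t ∈ (0,1]} 1 / (ρ(t) t^{1/α}) < ∞` -/
  sup_lt_top : (⨆ t ∈ Set.Ioc (0 : ℝ) 1, (ENNReal.ofReal (ρ t * t ^ (1 / α)))⁻¹) < ∞
  /-- `1 / F̄(τ_B(0))` is a random variable (up to a null set), so that its expectation makes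
  sense -/
  aemeasurable : AEMeasurable (fun ω => (tailFun ρ (exitTime R X 0 ω))⁻¹) P
  /-- `E [1 / F̄(τ_B(0))] < ∞` -/
  expectation_lt_top : (∫⁻ ω, (tailFun ρ (exitTime R X 0 ω))⁻¹ ∂P) < ∞

/-- `ρ(t) = κ₁ t^{δ-1} e^{-t} 1_{[0,1]}(t) + κ₂ t^{-a} 1_{(1,∞)}(t)`. -/
def rhoDensity (κ₁ κ₂ δ a : ℝ) (t : ℝ) : ℝ :=
  Set.indicator (Set.Icc 0 1) (fun s : ℝ => κ₁ * s ^ (δ - 1) * Real.exp (-s)) t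
    + Set.indicator (Set.Ioi 1) (fun s : ℝ => κ₂ / s ^ a) t

end

/-!
By independence of the increments, staying in `B(0, R)` up to time `n` forces `n` independent copies
of `X 1 - X 0` to have norm less than `2 * R`. Such an increment is not bounded, since otherwise its
characteristic function `exp (-‖ξ‖ ^ α)` would be at least `1 - O(‖ξ‖ ^ 2)` near `0`, which is
impossible for `α < 2`. So the exit time has a geometric tail, whereas `1 / F̄(s)` grows only like
`s ^ (a - 1)`.

The measurability of the exit time `τ` is the delicate point, because the event `τ < t` involves
uncountably many times, and the path may approach the sphere without reaching it. But `τ < t` can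
differ from the measurable event `R ≤ sup_{s < t} ‖X s‖` only if the supremum is exactly `R`, and by
self-similarity this is a null event for all but countably many `t`.
-/

section IndependentIncrements

variable {Ω : Type*} [MeasurableSpace Ω] {P : Measure Ω}

lemma exists_monotone_seq_of_finset {T : Type*} [LinearOrder T] [OrderBot T] (I : Finset T) :
    ∃ t : ℕ → T, Monotone t ∧ t 0 = ⊥ ∧ ∀ i ∈ I, i ∈ Set.range t := by
  have hcard : 0 < (insert ⊥ I).card := Finset.card_pos.2 (Finset.insert_nonempty _ _)
  refine ⟨fun k => (insert ⊥ I).orderEmbOfFin rfl ⟨min k ((insert ⊥ I).card - 1), by omega⟩,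
    fun j k hjk => ?_, ?_, fun i hi => ?_⟩
  · exact (OrderEmbedding.monotone _) (Fin.mk_le_mk.2 (min_le_min_right _ hjk))
  · simp only [Nat.zero_min, Finset.orderEmbOfFin_zero rfl hcard]
    exact le_bot_iff.1 (Finset.min'_le _ _ (Finset.mem_insert_self _ _))
  · have hi' : i ∈ Set.range ((insert ⊥ I).orderEmbOfFin rfl) := by
      rw [Finset.range_orderEmbOfFin]
      exact Finset.mem_insert_of_mem hi
    obtain ⟨j, rfl⟩ := hi'
    exact ⟨j, congrArg _ (Fin.ext (min_eq_left (by omega)))⟩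

lemma identDistrib_of_hasIndepIncrements {T E : Type*} [LinearOrder T] [OrderBot T]
    [AddCommGroup E] [MeasurableSpace E] [MeasurableAdd₂ E] {X Y : T → Ω → E}
    (hXm : ∀ t, Measurable (X t)) (hYm : ∀ t, Measurable (Y t))
    (hX : HasIndepIncrements X P) (hY : HasIndepIncrements Y P)
    (hX0 : ∀ᵐ ω ∂P, X ⊥ ω = 0) (hY0 : ∀ᵐ ω ∂P, Y ⊥ ω = 0)
    (h : ∀ s t, s ≤ t →
      IdentDistrib (fun ω => X t ω - X s ω) (fun ω => Y t ω - Y s ω) P P) :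
    IdentDistrib (fun ω => (X · ω)) (fun ω => (Y · ω)) P P := by
  have : IsProbabilityMeasure P := (hX 0 (fun _ => ⊥) monotone_const).isProbabilityMeasure
  refine (identDistrib_iff_forall_finset_identDistrib (measurable_pi_lambda _ hXm).aemeasurable
    (measurable_pi_lambda _ hYm).aemeasurable).2 fun I => ?_
  obtain ⟨t, ht, ht0, hI⟩ := exists_monotone_seq_of_finset I
  choose k hk using fun i : I => hI i i.2
  have hincr := IdentDistrib.pi (fun n => h (t n) (t (n + 1)) (ht n.le_succ))
    (hX.nat ht) (hY.nat ht)
  have hsum : Measurable fun (x : ℕ → E) (i : I) => ∑ n ∈ Finset.range (k i), x n := by fun_prop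
  have hrestrict : ∀ Z : T → Ω → E, (∀ᵐ ω ∂P, Z ⊥ ω = 0) →
      (fun ω => I.restrict (Z · ω)) =ᵐ[P]
        fun ω i => ∑ n ∈ Finset.range (k i), (Z (t (n + 1)) ω - Z (t n) ω) := fun Z hZ0 => by
    filter_upwards [hZ0] with ω hω
    funext i
    rw [Finset.sum_range_sub (fun n => Z (t n) ω), ht0, hω, sub_zero, hk, Finset.restrict]
  have hIm : ∀ Z : T → Ω → E, (∀ s, Measurable (Z s)) →
      AEMeasurable (fun ω => I.restrict (Z · ω)) P := fun Z hZ =>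
    (measurable_pi_lambda _ fun i : I => hZ i).aemeasurable
  exact ((IdentDistrib.of_ae_eq (hIm X hXm) (hrestrict X hX0)).trans (hincr.comp hsum)).trans
    (IdentDistrib.of_ae_eq (hIm Y hYm) (hrestrict Y hY0)).symm

lemma measure_forall_norm_lt_le_prod {T E : Type*} [Preorder T] [NormedAddCommGroup E]
    [MeasurableSpace E] [OpensMeasurableSpace E] {X : T → Ω → E} (hX : HasIndepIncrements X P)
    {t : ℕ → T} (ht : Monotone t) (R : ℝ) (n : ℕ) :
    P {ω | ∀ k ≤ n, ‖X (t k) ω‖ < R}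
      ≤ ∏ k ∈ Finset.range n, P {ω | ‖X (t (k + 1)) ω - X (t k) ω‖ < 2 * R} := by
  have hball : MeasurableSet {x : E | ‖x‖ < 2 * R} :=
    measurableSet_lt measurable_norm measurable_const
  refine le_trans ?_ ((hX.nat ht).meas_biInter (S := Finset.range n)
    (s := fun k => {ω | ‖X (t (k + 1)) ω - X (t k) ω‖ < 2 * R}) fun k _ => ⟨_, hball, rfl⟩).le
  refine measure_mono fun ω hω => Set.mem_iInter₂.2 fun k hk => ?_
  have hk : k < n := Finset.mem_range.1 hk
  calc ‖X (t (k + 1)) ω - X (t k) ω‖ ≤ ‖X (t (k + 1)) ω‖ + ‖X (t k) ω‖ := norm_sub_le _ _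
    _ < R + R := add_lt_add (hω (k + 1) hk) (hω k hk.le)
    _ = 2 * R := (two_mul R).symm

end IndependentIncrements

section RunningSup

variable {E : Type*} [NormedAddCommGroup E]

/-- The running supremum `sup_{s < t} ‖f s‖` of a right-continuous path. Only the times `t * q`
with `q < 1` in a fixed countable dense set are used: this makes the supremum a measurable
functional of the path and compatible with changes of the time scale. -/
noncomputable def runningSup (f : ℝ≥0 → E) (t : ℝ≥0) : ℝ≥0∞ :=
  ⨆ (n : ℕ) (_ : TopologicalSpace.denseSeq ℝ≥0 n < 1), ‖f (t * TopologicalSpace.denseSeq ℝ≥0 n)‖ₑ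

lemma exists_lt_of_lt_runningSup {f : ℝ≥0 → E} {t : ℝ≥0} (ht : 0 < t) {r : ℝ≥0∞}
    (h : r < runningSup f t) : ∃ s < t, r < ‖f s‖ₑ := by
  simp only [runningSup, lt_iSup_iff] at h
  obtain ⟨n, hn, hr⟩ := h
  exact ⟨_, mul_lt_of_lt_one_right ht hn, hr⟩

lemma enorm_le_runningSup {f : ℝ≥0 → E} {s t : ℝ≥0}
    (hf : ContinuousWithinAt f (Set.Ici s) s) (hst : s < t) : ‖f s‖ₑ ≤ runningSup f t := by
  have ht : 0 < t := bot_le.trans_lt hst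
  refine le_of_forall_lt fun r hr => ?_
  have hnear : ∀ᶠ u in 𝓝[>] s, r < ‖f u‖ₑ :=
    (hf.mono Set.Ioi_subset_Ici_self).enorm.eventually (lt_mem_nhds hr)
  obtain ⟨v, hsv, hv⟩ := (mem_nhdsGT_iff_exists_Ioo_subset' hst).1
    (inter_mem hnear (Ioo_mem_nhdsGT hst))
  obtain ⟨q, ⟨n, rfl⟩, hsq, hqv⟩ := (TopologicalSpace.denseRange_denseSeq ℝ≥0).exists_between
    (div_lt_div_of_pos_right (Set.mem_Ioi.1 hsv) ht)
  obtain ⟨hr', -, hqt⟩ := hv ⟨(div_lt_iff₀' ht).1 hsq, (lt_div_iff₀' ht).1 hqv⟩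
  exact hr'.trans_le (le_iSup₂_of_le n ((mul_lt_iff_lt_one_right ht).1 hqt) le_rfl)

lemma measurable_runningSup [MeasurableSpace E] [OpensMeasurableSpace E] {Ω : Type*}
    [MeasurableSpace Ω] {X : ℝ≥0 → Ω → E} (hX : ∀ t, Measurable (X t)) (t : ℝ≥0) :
    Measurable fun ω => runningSup (X · ω) t :=
  Measurable.iSup fun _ => Measurable.iSup fun _ => (hX _).enorm

end RunningSup

section SelfSimilar

variable {Ω E : Type*} [MeasurableSpace Ω] {P : Measure Ω} [NormedAddCommGroup E]
  [NormedSpace ℝ E] [MeasurableSpace E] {X : ℝ≥0 → Ω → E} {H : ℝ}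

/-- `X` is self-similar with Hurst index `H`: for every `c > 0` the processes `(X (c t))_t` and
`(c ^ H X t)_t` have the same law on the space of paths. -/
def IsSelfSimilar (H : ℝ) (X : ℝ≥0 → Ω → E) (P : Measure Ω) : Prop :=
  ∀ c : ℝ≥0, 0 < c →
    IdentDistrib (fun ω t => X (c * t) ω) (fun ω t => (c : ℝ) ^ H • X t ω) P P

variable [OpensMeasurableSpace E]

lemma IsSelfSimilar.identDistrib_runningSup (hX : IsSelfSimilar H X P) {t : ℝ≥0} (ht : 0 < t) :
    IdentDistrib (fun ω => runningSup (X · ω) t)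
      (fun ω => ‖(t : ℝ) ^ H‖ₑ * runningSup (X · ω) 1) P P := by
  simpa only [Function.comp_def, runningSup, one_mul, enorm_smul, ENNReal.mul_iSup] using
    (hX t ht).comp (measurable_runningSup (X := fun s f => f s) measurable_pi_apply 1)

lemma IsSelfSimilar.measure_runningSup_eq (hX : IsSelfSimilar H X P) {t : ℝ≥0} (ht : 0 < t)
    (r : ℝ≥0∞) :
    P {ω | runningSup (X · ω) t = r} = P {ω | runningSup (X · ω) 1 = r / ‖(t : ℝ) ^ H‖ₑ} := by
  have hc : ‖(t : ℝ) ^ H‖ₑ ≠ 0 := by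
    rw [enorm_ne_zero]
    exact (Real.rpow_pos_of_pos ht H).ne'
  simp only [ENNReal.eq_div_iff hc enorm_ne_top]
  exact (hX.identDistrib_runningSup ht).measure_mem_eq (measurableSet_singleton r)

lemma injOn_div_enorm_rpow {r : ℝ≥0∞} (hr0 : r ≠ 0) (hr : r ≠ ∞) (hH : H ≠ 0) :
    Set.InjOn (fun t : ℝ≥0 => r / ‖(t : ℝ) ^ H‖ₑ) (Set.Ioi 0) := by
  intro s _ t _ hst
  simp only [div_eq_mul_inv] at hst
  have hpow : ‖(s : ℝ) ^ H‖ₑ = ‖(t : ℝ) ^ H‖ₑ :=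
    inv_injective ((ENNReal.mul_right_inj hr0 hr).1 hst)
  simp only [← NNReal.coe_rpow, Real.enorm_of_nonneg, NNReal.coe_nonneg, ENNReal.ofReal_coe_nnreal,
    ENNReal.coe_inj] at hpow
  exact NNReal.rpow_left_injective hH hpow

/-- By scaling, `sup_{s < t} ‖X s‖ = r` has positive probability only if `r / t ^ H` is an atom of
the law of `sup_{s < 1} ‖X s‖`, which has at most countably many atoms. -/
lemma IsSelfSimilar.dense_runningSup_ne [SFinite P] (hX : IsSelfSimilar H X P) (hH : H ≠ 0)
    (hXm : ∀ t, Measurable (X t)) {r : ℝ≥0∞} (hr0 : r ≠ 0) (hr : r ≠ ∞) :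
    Dense {t : ℝ≥0 | 0 < t ∧ ∀ᵐ ω ∂P, runningSup (X · ω) t ≠ r} := by
  have hatoms : {x : ℝ≥0∞ | 0 < P {ω | runningSup (X · ω) 1 = x}}.Countable :=
    Measure.countable_meas_level_set_pos (measurable_runningSup hXm 1)
  have hbad : {t : ℝ≥0 | 0 < t ∧ 0 < P {ω | runningSup (X · ω) t = r}}.Countable := by
    refine Set.MapsTo.countable_of_injOn (f := fun t : ℝ≥0 => r / ‖(t : ℝ) ^ H‖ₑ)
      (fun t ht => ?_) ((injOn_div_enorm_rpow hr0 hr hH).mono fun t ht => ht.1) hatoms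
    exact ht.2.trans_eq (hX.measure_runningSup_eq ht.1 r)
  refine dense_of_exists_between fun a b hab => ?_
  obtain ⟨t, ht, hat, htb⟩ := ((hbad.image NNReal.toReal).dense_compl ℝ).exists_between
    (NNReal.coe_lt_coe.2 hab)
  have ht0 : 0 < t := a.2.trans_lt hat
  lift t to ℝ≥0 using ht0.le
  refine ⟨t, ⟨ht0, ?_⟩, hat, htb⟩
  by_contra hae
  refine ht ⟨t, ⟨ht0, pos_iff_ne_zero.2 fun h0 => hae ?_⟩, rfl⟩
  exact ae_iff.2 (by simpa only [ne_eq, not_not] using h0)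

end SelfSimilar

section ExitTime

variable {Ω : Type*} {d : ℕ} {R : ℝ} {X : ℝ≥0 → Ω → EuclideanSpace ℝ (Fin d)}

lemma exitTime_lt_iff {ω : Ω} {s : ℝ≥0∞} :
    exitTime R X 0 ω < s ↔ ∃ t : ℝ≥0, R ≤ ‖X t ω‖ ∧ (t : ℝ≥0∞) < s := by
  simp only [exitTime, zero_add, mem_ball_zero_iff, not_lt, iInf_lt_iff, exists_prop]

lemma norm_lt_of_lt_exitTime {ω : Ω} {t : ℝ≥0} (h : (t : ℝ≥0∞) < exitTime R X 0 ω) :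
    ‖X t ω‖ < R := by
  by_contra! hR
  exact h.not_ge (iInf₂_le t (by simpa using hR))

variable [MeasurableSpace Ω] {P : Measure Ω}

lemma exitTime_lt_ae_eq_le_runningSup
    (hcont : ∀ᵐ ω ∂P, ∀ s, ContinuousWithinAt (X · ω) (Set.Ici s) s) {t : ℝ≥0} (ht : 0 < t)
    (hne : ∀ᵐ ω ∂P, runningSup (X · ω) t ≠ ENNReal.ofReal R) :
    {ω | exitTime R X 0 ω < t} =ᵐ[P] {ω | ENNReal.ofReal R ≤ runningSup (X · ω) t} := by
  filter_upwards [hcont, hne] with ω hω hneω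
  refine propext ⟨fun h => ?_, fun h => ?_⟩
  · obtain ⟨s, hs, hst⟩ := exitTime_lt_iff.1 h
    calc ENNReal.ofReal R ≤ ‖X s ω‖ₑ := by
          rw [← ofReal_norm]; exact ENNReal.ofReal_le_ofReal hs
      _ ≤ runningSup (X · ω) t := enorm_le_runningSup (hω s) (ENNReal.coe_lt_coe.1 hst)
  · obtain ⟨s, hst, hs⟩ := exists_lt_of_lt_runningSup ht (lt_of_le_of_ne h hneω.symm)
    rw [← ofReal_norm] at hs
    exact exitTime_lt_iff.2 ⟨s, (ENNReal.ofReal_le_ofReal_iff (norm_nonneg _)).1 hs.le,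
      ENNReal.coe_lt_coe.2 hst⟩

lemma aemeasurable_exitTime_of_dense (hXm : ∀ t, Measurable (X t))
    (hcont : ∀ᵐ ω ∂P, ∀ s, ContinuousWithinAt (X · ω) (Set.Ici s) s)
    (hD : Dense {t : ℝ≥0 | 0 < t ∧ ∀ᵐ ω ∂P, runningSup (X · ω) t ≠ ENNReal.ofReal R}) :
    AEMeasurable (exitTime R X 0) P := by
  obtain ⟨D, hDs, hDc, hDd⟩ := hD.exists_countable_dense_subset
  suffices hnull : ∀ x, NullMeasurableSet (exitTime R X 0 ⁻¹' Set.Iio x) P from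
    NullMeasurable.aemeasurable (measurable_of_Iio (δ := NullMeasurableSpace Ω P) hnull)
  intro x
  have hunion : exitTime R X 0 ⁻¹' Set.Iio x
      = ⋃ t ∈ {t ∈ D | (t : ℝ≥0∞) ≤ x}, {ω | exitTime R X 0 ω < t} := by
    ext ω
    simp only [Set.mem_preimage, Set.mem_Iio, Set.mem_iUnion, Set.mem_ofPred_eq, exists_prop]
    refine ⟨fun hω => ?_, fun ⟨t, ht, hω⟩ => hω.trans_le ht.2⟩
    obtain ⟨u, hτu, hux⟩ := ENNReal.lt_iff_exists_nnreal_btwn.1 hω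
    obtain ⟨s, hs, hsu⟩ := exitTime_lt_iff.1 hτu
    obtain ⟨t, htD, hst, htu⟩ := hDd.exists_between (ENNReal.coe_lt_coe.1 hsu)
    exact ⟨t, ⟨htD, (ENNReal.coe_lt_coe.2 htu).le.trans hux.le⟩,
      exitTime_lt_iff.2 ⟨s, hs, ENNReal.coe_lt_coe.2 hst⟩⟩
  rw [hunion]
  refine NullMeasurableSet.biUnion (hDc.mono (Set.sep_subset _ _)) fun t ht => ?_
  obtain ⟨ht0, hne⟩ := hDs ht.1
  exact (measurableSet_le measurable_const (measurable_runningSup hXm t)).nullMeasurableSet.congr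
    (exitTime_lt_ae_eq_le_runningSup hcont ht0 hne).symm

end ExitTime

namespace IsSymmetricStableProcess

variable {Ω : Type*} [MeasurableSpace Ω] {P : Measure Ω} {d : ℕ} {α : ℝ}
  {X : ℝ≥0 → Ω → EuclideanSpace ℝ (Fin d)}

lemma isProbabilityMeasure (hX : IsSymmetricStableProcess α X P) : IsProbabilityMeasure P :=
  (hX.indep_increments 0 (fun _ => 0) monotone_const).isProbabilityMeasure

lemma identDistrib_increment_smul (hX : IsSymmetricStableProcess α X P) (hα : α ≠ 0)
    (c h s s' : ℝ≥0) :
    IdentDistrib (fun ω => X (s + c * h) ω - X s ω)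
      (fun ω => (c : ℝ) ^ (1 / α) • (X (s' + h) ω - X s' ω)) P P := by
  have := hX.isProbabilityMeasure
  have hm : ∀ u v, Measurable (fun ω => X u ω - X v ω) := fun u v =>
    (hX.measurable u).sub (hX.measurable v)
  have hm' := (hm (s' + h) s').const_smul ((c : ℝ) ^ (1 / α))
  refine ⟨(hm _ _).aemeasurable, hm'.aemeasurable, ?_⟩
  have := Measure.isProbabilityMeasure_map (μ := P) (hm (s + c * h) s).aemeasurable
  have := Measure.isProbabilityMeasure_map (μ := P) hm'.aemeasurable
  have hnorm (ξ : EuclideanSpace ℝ (Fin d)) :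
      ‖(c : ℝ) ^ (1 / α) • ξ‖ ^ α = c * ‖ξ‖ ^ α := by
    have hc : (0 : ℝ) ≤ (c : ℝ) ^ (1 / α) := Real.rpow_nonneg c.2 _
    rw [norm_smul, Real.norm_of_nonneg hc, Real.mul_rpow hc (norm_nonneg _),
      ← Real.rpow_mul c.coe_nonneg,
      one_div_mul_cancel hα, Real.rpow_one]
  refine Measure.ext_of_charFun (funext fun ξ => ?_)
  rw [charFun_map_smul_comp (hm _ _).aemeasurable, hX.charFun_increment, hX.charFun_increment,
    hnorm, NNReal.coe_mul, mul_comm (c : ℝ), mul_assoc]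

lemma isSelfSimilar (hX : IsSymmetricStableProcess α X P) (hα : α ≠ 0) :
    IsSelfSimilar (1 / α) X P := by
  intro c _
  refine identDistrib_of_hasIndepIncrements (fun t => hX.measurable _)
    (fun t => (measurable_const_smul ((c : ℝ) ^ (1 / α))).comp (hX.measurable t))
    (fun n t ht => hX.indep_increments n (fun i => c * t i) (ht.const_mul zero_le))
    (hX.indep_increments.smul _) ?_ ?_ fun s t hst => ?_
  · simpa only [bot_eq_zero', mul_zero] using hX.start
  · filter_upwards [hX.start] with ω hω
    rw [bot_eq_zero', hω, smul_zero]
  · simpa only [← smul_sub, ← mul_add, add_tsub_cancel_of_le hst] using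
      hX.identDistrib_increment_smul hα c (t - s) (c * s) s

lemma aemeasurable_exitTime (hX : IsSymmetricStableProcess α X P) (hα : α ≠ 0) {R : ℝ}
    (hR : 0 < R) : AEMeasurable (exitTime R X 0) P := by
  have := hX.isProbabilityMeasure
  refine aemeasurable_exitTime_of_dense hX.measurable
    (hX.cadlag.mono fun ω hω s => (hω s).1) ?_
  exact (hX.isSelfSimilar hα).dense_runningSup_ne (one_div_ne_zero hα) hX.measurable
    (ENNReal.ofReal_pos.2 hR).ne' ENNReal.ofReal_ne_top

end IsSymmetricStableProcess

section Unbounded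

lemma one_sub_sq_le_re_charFun {E : Type*} [NormedAddCommGroup E] [InnerProductSpace ℝ E]
    [MeasurableSpace E] [OpensMeasurableSpace E] [SecondCountableTopology E] {μ : Measure E}
    [IsProbabilityMeasure μ] {r : ℝ} (h : ∀ᵐ x ∂μ, ‖x‖ ≤ r) (ξ : E) :
    1 - (r * ‖ξ‖) ^ 2 / 2 ≤ (charFun μ ξ).re := by
  have hexp : Integrable (fun x => Complex.exp ((inner ℝ x ξ : ℝ) * Complex.I)) μ :=
    Integrable.of_bound (C := 1) (Measurable.aestronglyMeasurable (by fun_prop))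
      (Eventually.of_forall fun x => (Complex.norm_exp_ofReal_mul_I _).le)
  have hcos : Integrable (fun x => Real.cos (inner ℝ x ξ)) μ := by
    simpa only [RCLike.re_eq_complex_re, Complex.exp_ofReal_mul_I_re] using hexp.re
  have hre : (charFun μ ξ).re = ∫ x, Real.cos (inner ℝ x ξ) ∂μ := by
    rw [charFun_apply, ← RCLike.re_eq_complex_re, ← integral_re hexp]
    simp only [RCLike.re_eq_complex_re, Complex.exp_ofReal_mul_I_re]
  calc 1 - (r * ‖ξ‖) ^ 2 / 2 = ∫ _, (1 - (r * ‖ξ‖) ^ 2 / 2) ∂μ := by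
        rw [integral_const, probReal_univ, one_smul]
    _ ≤ ∫ x, Real.cos (inner ℝ x ξ) ∂μ := by
        refine integral_mono_ae (integrable_const _) hcos ?_
        filter_upwards [h] with x hx
        have hinner : |inner ℝ x ξ| ≤ r * ‖ξ‖ :=
          (abs_real_inner_le_norm _ _).trans (by gcongr)
        refine le_trans ?_ Real.one_sub_sq_div_two_le_cos
        linarith [sq_le_sq' (abs_le.1 hinner).1 (abs_le.1 hinner).2]
    _ = (charFun μ ξ).re := hre.symm

lemma exists_exp_neg_rpow_lt {α : ℝ} (hα : α ∈ Set.Ioo (0 : ℝ) 2) (c : ℝ) :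
    ∃ x > 0, Real.exp (-x ^ α) < 1 - c * x ^ 2 := by
  have hlim := tendsto_rpow_neg_nhdsGT_zero (y := α - 2) (by linarith [hα.2])
  obtain ⟨x, hx, hx0, hx1⟩ := ((hlim.eventually_gt_atTop (2 * c)).and
    (Ioo_mem_nhdsGT (zero_lt_one' ℝ))).exists
  refine ⟨x, hx0, ?_⟩
  set y := x ^ α
  have hy0 : 0 < y := Real.rpow_pos_of_pos hx0 _
  have hy1 : y < 1 := Real.rpow_lt_one hx0.le hx1 hα.1
  have hexp : Real.exp (-y) ≤ 1 / (1 + y) := by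
    rw [Real.exp_neg, ← one_div]
    exact one_div_le_one_div_of_le (by positivity) (by linarith [Real.add_one_le_exp y])
  have hcy : 2 * (c * x ^ 2) < y := by
    calc 2 * (c * x ^ 2) = 2 * c * x ^ 2 := by ring
      _ < x ^ (α - 2) * x ^ 2 := by gcongr
      _ = y := by rw [← Real.rpow_natCast, ← Real.rpow_add hx0, Nat.cast_ofNat, sub_add_cancel]
  calc Real.exp (-y) ≤ 1 / (1 + y) := hexp
    _ ≤ 1 - y / 2 := by rw [div_le_iff₀ (by positivity)]; nlinarith
    _ < 1 - c * x ^ 2 := by linarith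

end Unbounded

namespace IsSymmetricStableProcess

variable {Ω : Type*} [MeasurableSpace Ω] {P : Measure Ω} {d : ℕ} {α : ℝ}
  {X : ℝ≥0 → Ω → EuclideanSpace ℝ (Fin d)}

lemma measure_norm_increment_lt_lt_one (hX : IsSymmetricStableProcess α X P) (hd : 0 < d)
    (hα : α ∈ Set.Ioo (0 : ℝ) 2) (r : ℝ) :
    P {ω | ‖X 1 ω - X 0 ω‖ < r} < 1 := by
  have := hX.isProbabilityMeasure
  have hm : Measurable (fun ω => X 1 ω - X 0 ω) := (hX.measurable 1).sub (hX.measurable 0)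
  have := Measure.isProbabilityMeasure_map (μ := P) hm.aemeasurable
  refine lt_of_le_of_ne prob_le_one fun hone => ?_
  have hbdd : ∀ᵐ x ∂P.map (fun ω => X 1 ω - X 0 ω), ‖x‖ ≤ r := by
    refine (ae_map_iff hm.aemeasurable (measurableSet_le measurable_norm measurable_const)).2 ?_
    filter_upwards [(prob_compl_eq_zero_iff (measurableSet_lt hm.norm measurable_const)).2 hone]
      with ω hω using le_of_lt hω
  obtain ⟨x, hx0, hx⟩ := exists_exp_neg_rpow_lt hα (r ^ 2 / 2)
  have hle := one_sub_sq_le_re_charFun hbdd (EuclideanSpace.single ⟨0, hd⟩ x)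
  have hchar := hX.charFun_increment 0 1 (EuclideanSpace.single ⟨0, hd⟩ x)
  rw [PiLp.norm_single, Real.norm_of_nonneg hx0.le] at hle hchar
  rw [zero_add, NNReal.coe_one, one_mul, ← Complex.ofReal_exp] at hchar
  rw [hchar, Complex.ofReal_re] at hle
  linarith

lemma measure_lt_exitTime_le (hX : IsSymmetricStableProcess α X P) (hα : α ≠ 0) (R : ℝ) (n : ℕ) :
    P {ω | n < exitTime R X 0 ω} ≤ P {ω | ‖X 1 ω - X 0 ω‖ < 2 * R} ^ n := by
  have hstat (k : ℕ) : P {ω | ‖X (k + 1 : ℕ) ω - X k ω‖ < 2 * R}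
      = P {ω | ‖X 1 ω - X 0 ω‖ < 2 * R} := by
    have hid := hX.identDistrib_increment_smul hα 1 1 k 0
    simp only [NNReal.coe_one, Real.one_rpow, one_smul, mul_one, zero_add] at hid
    rw [Nat.cast_succ]
    exact hid.measure_mem_eq (measurableSet_lt measurable_norm measurable_const)
  calc P {ω | n < exitTime R X 0 ω} ≤ P {ω | ∀ k ≤ n, ‖X (k : ℕ) ω‖ < R} :=
        measure_mono fun ω hω k hk =>
          norm_lt_of_lt_exitTime (lt_of_le_of_lt (by exact_mod_cast hk) hω)
    _ ≤ ∏ k ∈ Finset.range n, P {ω | ‖X (k + 1 : ℕ) ω - X k ω‖ < 2 * R} :=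
        measure_forall_norm_lt_le_prod hX.indep_increments Nat.mono_cast R n
    _ = P {ω | ‖X 1 ω - X 0 ω‖ < 2 * R} ^ n := by
        rw [Finset.prod_congr rfl fun k _ => hstat k, Finset.prod_const, Finset.card_range]

end IsSymmetricStableProcess

section GeometricTail

variable {Ω : Type*} {T : Ω → ℝ≥0∞} {g : ℝ≥0∞ → ℝ≥0∞}

lemma comp_le_add_tsum_indicator (hg : Monotone g) {ω : Ω} (hω : T ω ≠ ∞) :
    g (T ω) ≤ g 0 + ∑' n : ℕ, {ω | n < T ω}.indicator (fun _ => g (n + 1)) ω := by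
  obtain ⟨t, ht⟩ : ∃ t : ℝ≥0, (t : ℝ≥0∞) = T ω := ⟨_, ENNReal.coe_toNNReal hω⟩
  rcases Nat.eq_zero_or_eq_succ_pred ⌈t⌉₊ with h0 | hn
  · rw [← ht, le_zero_iff.1 (Nat.ceil_eq_zero.1 h0)]
    exact le_self_add
  · set n := ⌈t⌉₊.pred
    have hnT : ω ∈ {ω | n < T ω} := by
      change (n : ℝ≥0∞) < T ω
      rw [← ht, ← ENNReal.coe_natCast, ENNReal.coe_lt_coe]
      exact Nat.lt_ceil.1 (hn ▸ n.lt_succ_self)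
    have hTn : T ω ≤ n + 1 := by
      rw [← ht]
      exact_mod_cast hn ▸ Nat.le_ceil t
    calc g (T ω) ≤ g (n + 1) := hg hTn
      _ = {ω | n < T ω}.indicator (fun _ => g (n + 1)) ω :=
        (Set.indicator_of_mem hnT fun _ => g (n + 1)).symm
      _ ≤ ∑' n : ℕ, {ω | n < T ω}.indicator (fun _ => g (n + 1)) ω :=
        ENNReal.le_tsum (f := fun n : ℕ => {ω | n < T ω}.indicator (fun _ => g (n + 1)) ω) n
      _ ≤ _ := le_add_self

variable [MeasurableSpace Ω] {μ : Measure Ω}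

lemma lintegral_comp_le_add_tsum (hT : AEMeasurable T μ) (hT_top : ∀ᵐ ω ∂μ, T ω ≠ ∞)
    (hg : Monotone g) :
    ∫⁻ ω, g (T ω) ∂μ ≤ g 0 * μ Set.univ + ∑' n : ℕ, g (n + 1) * μ {ω | n < T ω} := by
  have hlt (n : ℕ) : NullMeasurableSet {ω | n < T ω} μ := nullMeasurableSet_lt aemeasurable_const hT
  calc ∫⁻ ω, g (T ω) ∂μ
      ≤ ∫⁻ ω, g 0 + ∑' n : ℕ, {ω | n < T ω}.indicator (fun _ => g (n + 1)) ω ∂μ :=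
        lintegral_mono_ae (hT_top.mono fun ω hω => comp_le_add_tsum_indicator hg hω)
    _ = g 0 * μ Set.univ + ∑' n : ℕ, g (n + 1) * μ {ω | n < T ω} := by
        rw [lintegral_add_left measurable_const, lintegral_const,
          lintegral_tsum fun n => aemeasurable_const.indicator₀ (hlt n)]
        simp only [lintegral_indicator_const₀ (hlt _)]

lemma ae_ne_top_of_geometric_tail {q : ℝ≥0∞} (hq : q < 1)
    (htail : ∀ n : ℕ, μ {ω | n < T ω} ≤ q ^ n) : ∀ᵐ ω ∂μ, T ω ≠ ∞ := by
  have hle (n : ℕ) : μ {ω | T ω = ∞} ≤ q ^ n :=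
    (measure_mono fun ω (hω : T ω = ∞) => (ENNReal.natCast_lt_top n).trans_eq hω.symm).trans
      (htail n)
  rw [ae_iff]
  simp only [ne_eq, not_not]
  exact le_zero_iff.1 (ge_of_tendsto' (ENNReal.tendsto_pow_atTop_nhds_zero_of_lt_one hq) hle)

lemma tsum_succ_pow_mul_geometric_ne_top (m : ℕ) {q : ℝ≥0∞} (hq : q < 1) :
    ∑' n : ℕ, ((n : ℝ≥0∞) + 1) ^ m * q ^ n ≠ ∞ := by
  lift q to ℝ≥0 using hq.ne_top
  have hq' : ‖(q : ℝ)‖ < 1 := by simpa using hq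
  have hO : (fun n : ℕ => ((n + 1 : ℕ) : ℝ)) =O[atTop] fun n : ℕ => (n : ℝ) :=
    Asymptotics.IsBigO.of_bound 2 <| by
      filter_upwards [eventually_ge_atTop 1] with n hn
      rw [Real.norm_natCast, Real.norm_natCast]
      exact_mod_cast (by omega : n + 1 ≤ 2 * n)
  have hsum : Summable fun n : ℕ => (((n + 1) ^ m * q ^ n : ℝ≥0) : ℝ) := by
    simpa using (summable_norm_mul_geometric_of_norm_lt_one (u := fun n => (n + 1) ^ m) hq'
      (by simpa only [Nat.cast_pow] using hO.pow m)).of_norm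
  simpa using ENNReal.tsum_coe_ne_top_iff_summable_coe.2 hsum

lemma lintegral_comp_lt_top_of_geometric_tail [IsFiniteMeasure μ] (hT : AEMeasurable T μ)
    {q : ℝ≥0∞} (hq : q < 1) (htail : ∀ n : ℕ, μ {ω | n < T ω} ≤ q ^ n) (hg : Monotone g)
    {C : ℝ≥0∞} (hC : C ≠ ∞) {m : ℕ} (hgC : ∀ n : ℕ, g (n + 1) ≤ C * (n + 1) ^ m) :
    ∫⁻ ω, g (T ω) ∂μ < ∞ := by
  have hg0 : g 0 ≤ C := by
    simpa using (hg zero_le).trans (hgC 0)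
  calc ∫⁻ ω, g (T ω) ∂μ ≤ g 0 * μ Set.univ + ∑' n : ℕ, g (n + 1) * μ {ω | n < T ω} :=
        lintegral_comp_le_add_tsum hT (ae_ne_top_of_geometric_tail hq htail) hg
    _ ≤ C * μ Set.univ + ∑' n : ℕ, C * (n + 1) ^ m * q ^ n := by
        gcongr with n
        exacts [hgC n, htail n]
    _ = C * μ Set.univ + C * ∑' n : ℕ, ((n : ℝ≥0∞) + 1) ^ m * q ^ n := by
        simp only [mul_assoc, ENNReal.tsum_mul_left]
    _ < ∞ := ENNReal.add_lt_top.2 ⟨ENNReal.mul_lt_top hC.lt_top (measure_lt_top μ _),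
        ENNReal.mul_lt_top hC.lt_top (tsum_succ_pow_mul_geometric_ne_top m hq).lt_top⟩

end GeometricTail

section Density

lemma tailFun_antitone (ρ : ℝ → ℝ) : Antitone (tailFun ρ) := fun _ _ hst =>
  lintegral_mono_set fun _ hu => ⟨hu.1, hst.trans_lt hu.2⟩

variable {κ₁ κ₂ δ a : ℝ}

lemma rhoDensity_of_mem_Ioc {t : ℝ} (ht : t ∈ Set.Ioc (0 : ℝ) 1) :
    rhoDensity κ₁ κ₂ δ a t = κ₁ * t ^ (δ - 1) * Real.exp (-t) := by
  rw [rhoDensity, Set.indicator_of_mem (Set.Ioc_subset_Icc_self ht),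
    Set.indicator_of_notMem (Set.notMem_Ioi.2 ht.2), add_zero]

lemma rhoDensity_of_one_lt {t : ℝ} (ht : 1 < t) : rhoDensity κ₁ κ₂ δ a t = κ₂ / t ^ a := by
  rw [rhoDensity, Set.indicator_of_notMem (fun h => ht.not_ge h.2),
    Set.indicator_of_mem (Set.mem_Ioi.2 ht), zero_add]

lemma iSup_inv_rhoDensity_mul_rpow_lt_top (hκ₁ : 0 < κ₁) {b : ℝ} (hδ : δ ≤ 1 - b) :
    (⨆ t ∈ Set.Ioc (0 : ℝ) 1, (ENNReal.ofReal (rhoDensity κ₁ κ₂ δ a t * t ^ b))⁻¹) < ∞ := by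
  have hpos : 0 < κ₁ * Real.exp (-1) := by positivity
  refine (iSup₂_le fun t ht => ?_).trans_lt (ENNReal.inv_lt_top.2 (ENNReal.ofReal_pos.2 hpos))
  refine ENNReal.inv_le_inv.2 (ENNReal.ofReal_le_ofReal ?_)
  have hpow : 1 ≤ t ^ (δ - 1 + b) :=
    Real.one_le_rpow_of_pos_of_le_one_of_nonpos ht.1 ht.2 (by linarith)
  calc κ₁ * Real.exp (-1) ≤ κ₁ * Real.exp (-t) := by gcongr; exact ht.2
    _ ≤ κ₁ * Real.exp (-t) * t ^ (δ - 1 + b) := le_mul_of_one_le_right (by positivity) hpow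
    _ = rhoDensity κ₁ κ₂ δ a t * t ^ b := by
        rw [rhoDensity_of_mem_Ioc ht, Real.rpow_add ht.1]; ring

lemma tailFun_rhoDensity (hκ₂ : 0 ≤ κ₂) (ha : 1 < a) {s : ℝ} (hs : 1 ≤ s) :
    tailFun (rhoDensity κ₁ κ₂ δ a) (ENNReal.ofReal s)
      = ENNReal.ofReal (κ₂ / (a - 1) * s ^ (1 - a)) := by
  have hs0 : 0 < s := zero_lt_one.trans_le hs
  have hset : {t : ℝ | 0 < t ∧ ENNReal.ofReal s < ENNReal.ofReal t} = Set.Ioi s := by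
    ext t
    exact ⟨fun h => (ENNReal.ofReal_lt_ofReal_iff h.1).1 h.2, fun h =>
      ⟨hs0.trans h, (ENNReal.ofReal_lt_ofReal_iff (hs0.trans h)).2 h⟩⟩
  have hrho : ∀ t ∈ Set.Ioi s, rhoDensity κ₁ κ₂ δ a t = κ₂ * t ^ (-a) := fun t ht => by
    rw [rhoDensity_of_one_lt (hs.trans_lt ht), Real.rpow_neg (hs0.trans ht).le, div_eq_mul_inv]
  have hint : IntegrableOn (fun t : ℝ => κ₂ * t ^ (-a)) (Set.Ioi s) :=
    (integrableOn_Ioi_rpow_of_lt (by linarith) hs0).const_mul κ₂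
  have hnonneg : ∀ᵐ t ∂volume.restrict (Set.Ioi s), 0 ≤ κ₂ * t ^ (-a) :=
    ae_restrict_of_forall_mem measurableSet_Ioi fun t ht =>
      mul_nonneg hκ₂ (Real.rpow_nonneg (hs0.trans ht).le _)
  calc tailFun (rhoDensity κ₁ κ₂ δ a) (ENNReal.ofReal s)
      = ∫⁻ t in Set.Ioi s, ENNReal.ofReal (κ₂ * t ^ (-a)) := by
        rw [tailFun, hset]
        exact setLIntegral_congr_fun measurableSet_Ioi fun t ht => by rw [hrho t ht]
    _ = ENNReal.ofReal (∫ t in Set.Ioi s, κ₂ * t ^ (-a)) :=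
        (ofReal_integral_eq_lintegral_ofReal hint hnonneg).symm
    _ = ENNReal.ofReal (κ₂ / (a - 1) * s ^ (1 - a)) := by
        rw [integral_const_mul, integral_Ioi_rpow_of_lt (by linarith) hs0, neg_add_eq_sub,
          ← neg_sub a 1, neg_div_neg_eq, mul_div_assoc', div_mul_eq_mul_div]

lemma inv_tailFun_rhoDensity_le (hκ₂ : 0 < κ₂) (ha : 1 < a) (n : ℕ) :
    (tailFun (rhoDensity κ₁ κ₂ δ a) (n + 1))⁻¹
      ≤ ENNReal.ofReal ((a - 1) / κ₂) * (n + 1) ^ ⌈a - 1⌉₊ := by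
  have hn : (1 : ℝ) ≤ n + 1 := le_add_of_nonneg_left n.cast_nonneg
  have hn0 : (0 : ℝ) < n + 1 := zero_lt_one.trans_le hn
  have : 0 < a - 1 := sub_pos.2 ha
  have hcast : ((n : ℝ≥0∞) + 1) = ENNReal.ofReal (n + 1) := by
    rw [ENNReal.ofReal_add n.cast_nonneg zero_le_one, ENNReal.ofReal_natCast, ENNReal.ofReal_one]
  rw [hcast, tailFun_rhoDensity hκ₂.le ha hn, ← ENNReal.ofReal_inv_of_pos (by positivity),
    ← ENNReal.ofReal_pow hn0.le, ← ENNReal.ofReal_mul (by positivity)]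
  refine ENNReal.ofReal_le_ofReal ?_
  calc (κ₂ / (a - 1) * ((n : ℝ) + 1) ^ (1 - a))⁻¹ = (a - 1) / κ₂ * ((n : ℝ) + 1) ^ (a - 1) := by
        rw [mul_inv, inv_div, ← Real.rpow_neg hn0.le, neg_sub]
    _ ≤ (a - 1) / κ₂ * ((n : ℝ) + 1) ^ ⌈a - 1⌉₊ := by
        rw [← Real.rpow_natCast]
        gcongr
        exact Nat.le_ceil _

end Density

theorem proposition3p5_general {Ω : Type*} [MeasurableSpace Ω] {P : Measure Ω} {d : ℕ}
    (hd : 0 < d) {α : ℝ} (hα : α ∈ Set.Ioo (0 : ℝ) 2) {R : ℝ} (hR : 0 < R)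
    {X : ℝ≥0 → Ω → EuclideanSpace ℝ (Fin d)} (hX : IsSymmetricStableProcess α X P)
    {δ : ℝ} (hδ : δ ≤ 1 - 1 / α) {a : ℝ} (ha : 1 < a)
    {κ₁ κ₂ : ℝ} (hκ₁ : 0 < κ₁) (hκ₂ : 0 < κ₂) :
    AssumptionC α R X P (rhoDensity κ₁ κ₂ δ a) := by
  have := hX.isProbabilityMeasure
  have hτ : AEMeasurable (exitTime R X 0) P := hX.aemeasurable_exitTime hα.1.ne' hR
  have hmono : Monotone fun s => (tailFun (rhoDensity κ₁ κ₂ δ a) s)⁻¹ :=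
    fun _ _ hst => ENNReal.inv_le_inv.2 (tailFun_antitone _ hst)
  exact
    { sup_lt_top := iSup_inv_rhoDensity_mul_rpow_lt_top hκ₁ hδ
      aemeasurable := hmono.measurable.comp_aemeasurable hτ
      expectation_lt_top := lintegral_comp_lt_top_of_geometric_tail (T := exitTime R X 0) hτ
        (hX.measure_norm_increment_lt_lt_one hd hα (2 * R)) (hX.measure_lt_exitTime_le hα.1.ne' R)
        hmono ENNReal.ofReal_ne_top (inv_tailFun_rhoDensity_le hκ₂ ha) }

theorem proposition3p5 {Ω : Type*} [MeasurableSpace Ω] (P : Measure Ω) [IsProbabilityMeasure P]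
    (d : ℕ) (hd : 2 ≤ d) (α : ℝ) (hα : α ∈ Set.Ioo (1 : ℝ) 2)
    (R : ℝ) (hR : 0 < R)
    (X : ℝ≥0 → Ω → EuclideanSpace ℝ (Fin d)) (hX : IsSymmetricStableProcess α X P)
    (δ : ℝ) (hδ : δ ∈ Set.Ioc (0 : ℝ) (1 - 1 / α)) (a : ℝ) (ha : 1 < a)
    (κ₁ κ₂ : ℝ) (hκ₁ : 0 < κ₁) (hκ₂ : 0 < κ₂)
    (hρ : (∫⁻ t in Set.Ioi (0 : ℝ), ENNReal.ofReal (rhoDensity κ₁ κ₂ δ a t)) = 1) :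
    AssumptionC α R X P (rhoDensity κ₁ κ₂ δ a) :=
  proposition3p5_general (by omega) ⟨zero_lt_one.trans hα.1, hα.2⟩ hR hX hδ.2 ha hκ₁ hκ₂
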